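/- Let $(X,d)$ be a compact metric space, $T:X\to X$ a continuous map, and $\mu$ a $T$-invariant Borel probability measure on $X$. For $x,y\in X$ put $$F(x,y)=\limsup_{n\to\infty}\frac1n\min_{\sigma\in S_n}\sum_{k=0}^{n-1}d\bigl(T^kx,T^{\sigma(k)}y\bigr),$$ where $S_n$ is the set of all permutations of $\{0,1,\dots,n-1\}$. Then $(X,T)$ is $\mu$-$F$-equicontinuous: for every $\tau>0$ there is a compact set $M\subset X$ with $\mu(M)>1-\tau$ such that for every $\epsilon>0$ there is $\delta>0$ such that for all $x,y\in M$, $d(x,y)<\delta$ implies $F(x,y)<\epsilon$. -/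

import Mathlib

open MeasureTheory Filter

noncomputable section

namespace WeakMean

variable {X : Type*} [MetricSpace X]

/-- `F_n(x, y) = (1/n) inf_σ ∑_{k<n} d(T^k x, T^{σ(k)} y)`, the infimum being over all permutations
`σ` of `{0, …, n-1}` (a nonempty finite set). Only `n ≥ 1` is meaningful; the value at `n = 0`
is `0` and does not affect the limsup below. -/
def weakMeanN (T : X → X) (n : ℕ) (x y : X) : ℝ :=
  (1 / (n : ℝ)) * ⨅ σ : Equiv.Perm (Fin n), ∑ k : Fin n, dist (T^[k] x) (T^[σ k] y)

/-- The weak-mean pseudometric `F(x, y) = limsup_n F_n(x, y)`. On a compact (hence bounded) space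
`0 ≤ F_n(x, y) ≤ diam X`, so this real limsup is the genuine one. -/
def weakMean (T : X → X) (x y : X) : ℝ :=
  limsup (fun n : ℕ => weakMeanN T n x y) atTop

/-- `μ`-`F`-equicontinuity of `(X, T)`: for every `τ > 0` there is a compact set `M` with
`μ M > 1 - τ` on which `F` is equicontinuous with respect to `d`. -/
def IsMuFEquicontinuous [MeasurableSpace X] (T : X → X) (μ : Measure X) : Prop :=
  ∀ τ : ℝ, 0 < τ → ∃ M : Set X, IsCompact M ∧ 1 - τ < μ.real M ∧
    ∀ ε : ℝ, 0 < ε → ∃ δ : ℝ, 0 < δ ∧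
      ∀ x ∈ M, ∀ y ∈ M, dist x y < δ → weakMean T x y < ε

end WeakMean

end

/-! Since the permutation is free, only the number of visits of each orbit segment to small cells
matters. Label `X` by finitely many cells of diameter at most `r`: an optimal matching of labels
bounds `F_n(x, y)` by `r` plus `diam X` times the total difference of visit frequencies
(`weakMeanN_le_add_sum`). By Birkhoff's theorem these frequencies converge almost everywhere, and by
Lusin's theorem the limits are continuous on a compact set of almost full measure. The radii `1 / (m
+ 1)` give only countably many cells, so one compact set serves every `ε`. -/

namespace WeakMean

/-- Two labellings of a finite set can be matched up to the total discrepancy of their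
label counts. -/
theorem exists_perm_card_ne_le {α β : Type*} [Fintype α] [DecidableEq α] [DecidableEq β]
    (a b : α → β) (s : Finset β) (hs : ∀ k, a k ∈ s) :
    ∃ σ : Equiv.Perm α, ((Finset.univ.filter fun k => a k ≠ b (σ k)).card : ℤ) ≤
      ∑ j ∈ s, |((Finset.univ.filter fun k => a k = j).card : ℤ) -
        (Finset.univ.filter fun k => b k = j).card| := by
  obtain ⟨σ, hσ⟩ := Finite.exists_max
    fun σ : Equiv.Perm α => (Finset.univ.filter fun k => a k = b (σ k)).card
  refine ⟨σ, ?_⟩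
  rw [Finset.card_eq_sum_card_fiberwise (f := a) (t := s) (fun k _ => hs k)]
  push_cast
  refine Finset.sum_le_sum fun j _ => ?_
  rw [Finset.filter_filter]
  rcases Finset.eq_empty_or_nonempty
    (Finset.univ.filter fun k => a k ≠ b (σ k) ∧ a k = j) with h | ⟨k₀, hk₀⟩
  · rw [h]; simp
  simp only [Finset.mem_filter, Finset.mem_univ, true_and] at hk₀
  obtain ⟨hne, rfl⟩ := hk₀
  -- Otherwise swapping `k₀` and `l` matches `k₀` and breaks no match, contradicting maximality. So
  -- every position of this label in `b` is matched, and the unmatched number is exactly the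
  -- difference of the counts.
  have key : ∀ l, b (σ l) = a k₀ → a l = a k₀ := by
    intro l hl
    by_contra hal
    refine absurd (hσ (σ * Equiv.swap k₀ l)) (not_le.2 (Finset.card_lt_card ?_))
    rw [Finset.ssubset_iff_of_subset]
    · exact ⟨k₀, Finset.mem_filter.2 ⟨Finset.mem_univ _, by simp [hl]⟩, by simpa using hne⟩
    · intro k hk
      simp only [Finset.mem_filter, Finset.mem_univ, true_and] at hk ⊢
      have h1 : k ≠ k₀ := by rintro rfl; exact hne hk
      have h2 : k ≠ l := by rintro rfl; exact hal (hk.trans hl)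
      simpa [Equiv.swap_apply_of_ne_of_ne h1 h2] using hk
  have hb : (Finset.univ.filter fun k => b k = a k₀).card =
      (Finset.univ.filter fun k => a k = b (σ k) ∧ a k = a k₀).card := by
    symm
    refine Finset.card_bij (fun k _ => σ k) ?_ (fun _ _ _ _ h => σ.injective h) ?_
    · intro k hk
      simp only [Finset.mem_filter, Finset.mem_univ, true_and] at hk ⊢
      exact hk.1.symm.trans hk.2
    · intro l hl
      simp only [Finset.mem_filter, Finset.mem_univ, true_and] at hl
      have := key (σ.symm l) (by simpa using hl)
      exact ⟨σ.symm l, by simp [this, hl], by simp⟩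
  have ha := Finset.card_filter_add_card_filter_not
    (s := Finset.univ.filter fun k => a k = a k₀) (fun k => a k = b (σ k))
  simp only [Finset.filter_filter] at ha
  simp only [and_comm (a := a _ = a k₀)] at ha
  rw [hb, ← ha]
  push_cast
  refine le_trans (le_of_eq ?_) (le_abs_self _)
  ring

/-- **Lusin's theorem** on a compact space, relative to a conull set. -/
theorem exists_isCompact_continuousOn {X Y : Type*} [TopologicalSpace X] [CompactSpace X]
    [MeasurableSpace X] [BorelSpace X] [TopologicalSpace Y] [SecondCountableTopology Y]
    [MeasurableSpace Y] [OpensMeasurableSpace Y] (μ : Measure X) [IsFiniteMeasure μ]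
    [μ.WeaklyRegular] {f : X → Y} (hf : Measurable f) {p : X → Prop} (hp : ∀ᵐ x ∂μ, p x)
    {ε : ENNReal} (hε : ε ≠ 0) :
    ∃ K : Set X, IsCompact K ∧ μ Kᶜ < ε ∧ (∀ x ∈ K, p x) ∧ ContinuousOn f K := by
  have hε3 : ε / 3 ≠ 0 := by simp [hε]
  obtain ⟨O, hpO, hO, hμO⟩ := Set.exists_isOpen_lt_of_lt {x | ¬ p x} (ε / 3)
    (by rw [ae_iff.1 hp]; simp [hε])
  set B := TopologicalSpace.countableBasis Y
  have : Countable B := (TopologicalSpace.countable_countableBasis Y).to_subtype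
  obtain ⟨η, hη0, hη⟩ := ENNReal.exists_pos_sum_of_countable' hε3 B
  have hBm : ∀ b : B, MeasurableSet (f ⁻¹' b) := fun b =>
    hf (TopologicalSpace.isOpen_of_mem_countableBasis b.2).measurableSet
  choose U hU hUo _ hUμ using fun b : B =>
    (hBm b).exists_isOpen_sdiff_lt (μ := μ) (measure_ne_top _ _) (ENNReal.half_pos (hη0 b).ne').ne'
  choose F hF hFc hFμ using fun b : B =>
    (hBm b).exists_isClosed_sdiff_lt (μ := μ) (measure_ne_top _ _)
      (ENNReal.half_pos (hη0 b).ne').ne'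
  -- Off `U b \ F b` the preimage of `b` coincides with the open set `U b`, so preimages of basic
  -- sets are relatively open.
  refine ⟨(O ∪ ⋃ b, U b \ F b)ᶜ, ?_, ?_, ?_, ?_⟩
  · exact (hO.union (isOpen_iUnion fun b => (hUo b).sdiff (hFc b))).isClosed_compl.isCompact
  · rw [compl_compl]
    have h1 : ∀ b, μ (U b \ F b) ≤ η b := by
      intro b
      calc μ (U b \ F b) ≤ μ (U b \ f ⁻¹' b ∪ f ⁻¹' b \ F b) := measure_mono (by
            intro x hx
            by_cases h : x ∈ f ⁻¹' (b : Set Y)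
            · exact Or.inr ⟨h, hx.2⟩
            · exact Or.inl ⟨hx.1, h⟩)
        _ ≤ η b / 2 + η b / 2 := (measure_union_le _ _).trans (add_le_add (hUμ b).le (hFμ b).le)
        _ = η b := ENNReal.add_halves _
    calc μ (O ∪ ⋃ b, U b \ F b) ≤ μ O + ∑' b, η b :=
          (measure_union_le _ _).trans
            (add_le_add le_rfl ((measure_iUnion_le _).trans (ENNReal.tsum_le_tsum h1)))
      _ < ε / 3 + ε / 3 := ENNReal.add_lt_add hμO hη
      _ ≤ ε / 3 + ε / 3 + ε / 3 := le_self_add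
      _ = ε := ENNReal.add_thirds _
  · intro x hx
    by_contra h
    exact hx (Or.inl (hpO h))
  · intro x hx
    rw [ContinuousWithinAt,
      (TopologicalSpace.isBasis_countableBasis Y).nhds_hasBasis.tendsto_right_iff]
    rintro V ⟨hV, hxV⟩
    filter_upwards [self_mem_nhdsWithin,
      mem_nhdsWithin_of_mem_nhds ((hUo ⟨V, hV⟩).mem_nhds (hU ⟨V, hV⟩ hxV))] with y hy hyU
    by_contra h
    exact hy (Or.inr (Set.mem_iUnion.2 ⟨⟨V, hV⟩, hyU, fun hyF => h (hF _ hyF)⟩))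

end WeakMean

/-! ### The maximal ergodic theorem -/

namespace WeakMean

/-- `maxSum T f n x` is the maximum of the Birkhoff sums `S_0 f x, …, S_n f x`. -/
noncomputable def maxSum {X : Type*} (T : X → X) (f : X → ℝ) : ℕ → X → ℝ
  | 0 => fun _ => 0
  | n + 1 => fun x => max 0 (f x + maxSum T f n (T x))

section MaxSum

variable {X : Type*} {T : X → X} {f : X → ℝ}

theorem maxSum_nonneg (n : ℕ) (x : X) : 0 ≤ maxSum T f n x := by
  cases n with
  | zero => exact le_rfl
  | succ n => exact le_max_left _ _

theorem monotone_maxSum (x : X) : Monotone fun n => maxSum T f n x := by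
  refine monotone_nat_of_le_succ fun n => ?_
  induction n generalizing x with
  | zero => exact maxSum_nonneg 1 x
  | succ n ih => exact max_le_max le_rfl (add_le_add le_rfl (ih (T x)))

theorem birkhoffSum_le_maxSum (n : ℕ) (x : X) : birkhoffSum T f n x ≤ maxSum T f n x := by
  induction n generalizing x with
  | zero => simp [maxSum]
  | succ n ih =>
    rw [birkhoffSum_succ']
    exact (add_le_add le_rfl (ih (T x))).trans (le_max_right _ _)

/-- A positive maximum is attained by a nonempty sum, which splits off `f x`. By invariance of the
measure the left side integrates to zero. -/
theorem maxSum_sub_le_indicator (n : ℕ) (x : X) :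
    maxSum T f n x - maxSum T f n (T x) ≤ {y | 0 < maxSum T f n y}.indicator f x := by
  by_cases hx : 0 < maxSum T f n x
  · rw [Set.indicator_of_mem (s := {y | 0 < maxSum T f n y}) hx]
    cases n with
    | zero => exact absurd hx (lt_irrefl _)
    | succ n =>
      have h1 : maxSum T f (n + 1) x = f x + maxSum T f n (T x) := by
        rcases max_choice 0 (f x + maxSum T f n (T x)) with h | h
        · exact absurd (h : maxSum T f (n + 1) x = 0) hx.ne'
        · exact h
      have h2 := monotone_maxSum (T := T) (f := f) (T x) n.le_succ
      simp only [Nat.succ_eq_add_one] at h2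
      linarith
  · rw [Set.indicator_of_notMem (s := {y | 0 < maxSum T f n y}) hx]
    linarith [maxSum_nonneg (T := T) (f := f) n (T x)]

variable [MeasurableSpace X]

theorem measurable_maxSum (hT : Measurable T) (hf : Measurable f) (n : ℕ) :
    Measurable (maxSum T f n) := by
  induction n with
  | zero => exact measurable_const
  | succ n ih => exact measurable_const.max (hf.add (ih.comp hT))

variable {μ : Measure X}

theorem integrable_maxSum (hT : MeasurePreserving T μ μ) (hfi : Integrable f μ) (n : ℕ) :
    Integrable (maxSum T f n) μ := by
  induction n with
  | zero => exact integrable_zero _ _ _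
  | succ n ih => exact (integrable_zero X ℝ μ).sup (hfi.add (hT.integrable_comp_of_integrable ih))

/-- A form of the **maximal ergodic theorem**: if every point of the support of `f` has a positive
Birkhoff sum, then `f` has nonnegative integral. -/
theorem integral_nonneg_of_exists_birkhoffSum_pos (hT : MeasurePreserving T μ μ)
    (hf : Measurable f) (hfi : Integrable f μ)
    (h : ∀ x, f x ≠ 0 → ∃ n, 0 < birkhoffSum T f n x) : 0 ≤ ∫ x, f x ∂μ := by
  have hset : ∀ n, MeasurableSet {y | 0 < maxSum T f n y} := fun n =>
    measurableSet_lt measurable_const (measurable_maxSum hT.measurable hf n)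
  have hn : ∀ n, 0 ≤ ∫ x, {y | 0 < maxSum T f n y}.indicator f x ∂μ := by
    intro n
    have hi := integrable_maxSum hT hfi n
    have hi' := hT.integrable_comp_of_integrable hi
    have h0 : ∫ x, maxSum T f n x - maxSum T f n (T x) ∂μ = 0 := by
      rw [integral_sub (f := maxSum T f n) (g := fun x => maxSum T f n (T x)) hi hi', sub_eq_zero]
      have := integral_map (μ := μ) hT.measurable.aemeasurable (f := maxSum T f n)
        (by rw [hT.map_eq]; exact hi.aestronglyMeasurable)
      rwa [hT.map_eq] at this
    exact h0.symm.le.trans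
      (integral_mono (hi.sub hi') (hfi.indicator (hset n)) (maxSum_sub_le_indicator n))
  -- The sets where `maxSum T f n` is positive increase with `n` and exhaust the support of `f`.
  refine ge_of_tendsto' (tendsto_integral_of_dominated_convergence (fun x => ‖f x‖)
    (fun n => (hfi.indicator (hset n)).aestronglyMeasurable) hfi.norm
    (fun n => ae_of_all _ fun x => norm_indicator_le_norm_self _ _)
    (ae_of_all _ fun x => ?_)) hn
  by_cases hx : f x = 0
  · have : ∀ n, {y | 0 < maxSum T f n y}.indicator f x = f x := fun n => by
      simp [Set.indicator_apply, hx]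
    simp only [this]
    exact tendsto_const_nhds
  · obtain ⟨N, hN⟩ := h x hx
    refine tendsto_const_nhds.congr' ?_
    filter_upwards [eventually_ge_atTop N] with n hn
    exact (Set.indicator_of_mem (s := {y | 0 < maxSum T f n y})
      (hN.trans_le ((birkhoffSum_le_maxSum N x).trans (monotone_maxSum x hn))) f).symm

end MaxSum

/-! ### Birkhoff's pointwise ergodic theorem -/

section Birkhoff

variable {X : Type*} {T : X → X} {f : X → ℝ}

theorem birkhoffSum_indicator_of_mapsTo {E : Set X} (hE : Set.MapsTo T E E) {x : X} (hx : x ∈ E)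
    (n : ℕ) : birkhoffSum T (E.indicator f) n x = birkhoffSum T f n x :=
  Finset.sum_congr rfl fun k _ => Set.indicator_of_mem (hE.iterate k hx) f

theorem abs_birkhoffAverage_le {C : ℝ} (hC : ∀ x, |f x| ≤ C) (n : ℕ) (x : X) :
    |birkhoffAverage ℝ T f n x| ≤ C := by
  have hC0 : 0 ≤ C := (abs_nonneg _).trans (hC x)
  rcases n.eq_zero_or_pos with rfl | hn
  · simpa using hC0
  have h : |birkhoffSum T f n x| ≤ n * C :=
    (Finset.abs_sum_le_sum_abs _ _).trans
      ((Finset.sum_le_sum fun k _ => hC _).trans (by simp))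
  have hn' : (0 : ℝ) < n := by exact_mod_cast hn
  rw [birkhoffAverage, smul_eq_mul, abs_mul, abs_inv, abs_of_pos hn', inv_mul_le_iff₀ hn']
  exact h

/-- The points whose Birkhoff averages are infinitely often smaller, by a definite amount,
than `a`. -/
def oftenBelow (T : X → X) (f : X → ℝ) (a : ℝ) : Set X :=
  {x | ∃ m : ℕ, ∃ᶠ n in atTop, birkhoffAverage ℝ T f n x + 1 / ((m : ℝ) + 1) < a}

/-- The averages at `x` and `T x` differ by a null sequence, which half of the margin `1 / (m + 1)`
absorbs. -/
theorem mapsTo_oftenBelow {C : ℝ} (hC : ∀ x, |f x| ≤ C) (a : ℝ) :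
    Set.MapsTo T (oftenBelow T f a) (oftenBelow T f a) := by
  rintro x ⟨m, hm⟩
  have hlim := tendsto_birkhoffAverage_apply_sub_birkhoffAverage' (E := ℝ) ℝ (g := f)
    (isBounded_iff_forall_norm_le.2 ⟨C, by rintro _ ⟨y, rfl⟩; exact hC y⟩) T x
  obtain ⟨k, hk⟩ := exists_nat_one_div_lt (K := ℝ)
    (ε := 1 / ((m : ℝ) + 1) / 2) (by positivity)
  refine ⟨k, (hm.and_eventually (hlim.eventually (gt_mem_nhds
    (show 0 < 1 / ((m : ℝ) + 1) / 2 by positivity)))).mono fun n hn => ?_⟩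
  linarith [hn.1, hn.2]

theorem exists_birkhoffSum_pos_of_mem_oftenBelow {a : ℝ} {x : X} (hx : x ∈ oftenBelow T f a) :
    ∃ n, 0 < birkhoffSum T (fun y => a - f y) n x := by
  obtain ⟨m, hm⟩ := hx
  -- Starting at `1` excludes `n = 0`, where the average is `0` by convention.
  obtain ⟨n, hn, hlt⟩ := frequently_atTop.1 hm 1
  refine ⟨n, ?_⟩
  have hn' : (0 : ℝ) < n := by exact_mod_cast hn
  have h1 : (0 : ℝ) < 1 / ((m : ℝ) + 1) := by positivity
  have h2 : (n : ℝ)⁻¹ * birkhoffSum T f n x < a := by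
    simp only [birkhoffAverage, smul_eq_mul] at hlt
    linarith
  rw [inv_mul_lt_iff₀ hn'] at h2
  simp only [birkhoffSum, Finset.sum_sub_distrib, Finset.sum_const, Finset.card_range,
    nsmul_eq_mul] at h2 ⊢
  linarith

variable [MeasurableSpace X]

theorem measurable_birkhoffAverage (hT : Measurable T) (hf : Measurable f) (n : ℕ) :
    Measurable (birkhoffAverage ℝ T f n) := by
  have h : Measurable (birkhoffSum T f n) := by
    unfold birkhoffSum
    exact Finset.measurable_sum _ fun k _ => hf.comp (hT.iterate k)
  exact h.const_smul (n : ℝ)⁻¹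

theorem measurableSet_oftenBelow (hT : Measurable T) (hf : Measurable f) (a : ℝ) :
    MeasurableSet (oftenBelow T f a) := by
  simp only [oftenBelow, frequently_atTop, Set.ofPred_exists, Set.ofPred_forall, Set.ofPred_and]
  refine .iUnion fun m => .iInter fun N => .iUnion fun n => (MeasurableSet.const _).inter
    (measurableSet_lt ((measurable_birkhoffAverage hT hf n).add_const _) measurable_const)

variable {μ : Measure X} [IsFiniteMeasure μ]

/-- Forward invariance of `E` lets the indicator pass through Birkhoff sums, so the maximal theorem
applies to `a - f` cut off to `E`. -/
theorem integral_indicator_nonneg_of_subset_oftenBelow (hT : MeasurePreserving T μ μ)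
    (hf : Measurable f) {C : ℝ} (hC : ∀ x, |f x| ≤ C) {a : ℝ} {E : Set X} (hE : MeasurableSet E)
    (hTE : Set.MapsTo T E E) (hsub : E ⊆ oftenBelow T f a) :
    0 ≤ ∫ x in E, (a - f x) ∂μ := by
  rw [← integral_indicator hE]
  have hi : Integrable f μ := .of_bound hf.aestronglyMeasurable C (ae_of_all _ hC)
  refine integral_nonneg_of_exists_birkhoffSum_pos hT ((measurable_const.sub hf).indicator hE)
    (((integrable_const a).sub hi).indicator hE) fun x hx => ?_
  have hxE : x ∈ E := Set.mem_of_indicator_ne_zero hx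
  simp only [birkhoffSum_indicator_of_mapsTo hTE hxE]
  exact exists_birkhoffSum_pos_of_mem_oftenBelow (hsub hxE)

/-- **Birkhoff's pointwise ergodic theorem** for bounded functions: almost everywhere, the
Birkhoff averages converge. -/
theorem ae_exists_tendsto_birkhoffAverage (hT : MeasurePreserving T μ μ)
    (hf : Measurable f) {C : ℝ} (hC : ∀ x, |f x| ≤ C) :
    ∀ᵐ x ∂μ, ∃ l, Tendsto (fun n => birkhoffAverage ℝ T f n x) atTop (nhds l) := by
  have hC' : ∀ x, |(-f) x| ≤ C := by simpa using hC
  have key : ∀ a b : ℚ, a < b →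
      ∀ᵐ x ∂μ, x ∉ oftenBelow T f a ∩ oftenBelow T (-f) (-b : ℝ) := by
    intro a b hab
    have hab' : (a : ℝ) < b := by exact_mod_cast hab
    set E := oftenBelow T f a ∩ oftenBelow T (-f) (-b : ℝ)
    have hE : MeasurableSet E := (measurableSet_oftenBelow hT.measurable hf _).inter
      (measurableSet_oftenBelow hT.measurable hf.neg _)
    have hTE : Set.MapsTo T E E := (mapsTo_oftenBelow hC _).inter_inter (mapsTo_oftenBelow hC' _)
    have h1 := integral_indicator_nonneg_of_subset_oftenBelow hT hf hC hE hTE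
      Set.inter_subset_left
    have h2 := integral_indicator_nonneg_of_subset_oftenBelow hT hf.neg hC' hE hTE
      Set.inter_subset_right
    have hi : Integrable f (μ.restrict E) :=
      .of_bound hf.aestronglyMeasurable C (ae_of_all _ hC)
    rw [integral_sub (integrable_const _) hi, integral_const] at h1
    rw [integral_sub (integrable_const _) hi.neg, integral_const, integral_neg'] at h2
    simp only [measureReal_restrict_apply_univ, smul_eq_mul] at h1 h2
    -- Adding `h1` and `h2` gives `0 ≤ (a - b) * μ.real E`, with `a < b`.
    have h3 : μ.real E = 0 := by
      have := measureReal_nonneg (μ := μ) (s := E)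
      nlinarith
    rw [measureReal_eq_zero_iff] at h3
    exact measure_eq_zero_iff_ae_notMem.1 h3
  have hall : ∀ᵐ x ∂μ, ∀ a b : ℚ, a < b → x ∉ oftenBelow T f a ∩ oftenBelow T (-f) (-b : ℝ) := by
    simpa only [ae_all_iff] using key
  filter_upwards [hall] with x hx
  refine tendsto_of_no_upcrossings (Rat.isDenseEmbedding_coe_real.dense) ?_
    (isBoundedUnder_of ⟨C, fun n => (abs_le.1 (abs_birkhoffAverage_le hC n x)).2⟩)
    (isBoundedUnder_of ⟨-C, fun n => (abs_le.1 (abs_birkhoffAverage_le hC n x)).1⟩)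
  rintro _ ⟨a, rfl⟩ _ ⟨b, rfl⟩ hab ⟨ha, hb⟩
  have hab' : a < b := by exact_mod_cast hab
  obtain ⟨m, hm⟩ := exists_nat_one_div_lt (K := ℝ) (ε := ((b : ℝ) - a) / 3) (by linarith)
  -- Moving both thresholds inward by a third of the gap makes room for the margin in `oftenBelow`.
  refine hx (a + (b - a) / 3) (b - (b - a) / 3) (by linarith) ⟨⟨m, ha.mono fun n hn => ?_⟩,
    ⟨m, hb.mono fun n hn => ?_⟩⟩
  · push_cast; linarith
  · have : birkhoffAverage ℝ T (-f) n x = -birkhoffAverage ℝ T f n x := by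
      simp [birkhoffAverage, birkhoffSum]
    push_cast; linarith

end Birkhoff

end WeakMean

/-! ### Visit frequencies, small cells and the conclusion -/

namespace WeakMean

theorem birkhoffSum_indicator_preimage {X : Type*} (T : X → X) (c : X → ℕ) (j n : ℕ) (x : X) :
    birkhoffSum T ((c ⁻¹' {j}).indicator fun _ => (1 : ℝ)) n x =
      (Finset.univ.filter fun k : Fin n => c (T^[k] x) = j).card := by
  rw [birkhoffSum, Finset.card_filter, ← Fin.sum_univ_eq_sum_range
    (fun k => (c ⁻¹' {j}).indicator (fun _ => (1 : ℝ)) (T^[k] x))]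
  push_cast
  refine Finset.sum_congr rfl fun k _ => ?_
  by_cases h : c (T^[k] x) = j
  · rw [if_pos h]
    exact Set.indicator_of_mem (s := c ⁻¹' {j}) h _
  · rw [if_neg h]
    exact Set.indicator_of_notMem (s := c ⁻¹' {j}) h _

theorem weakMeanN_nonneg {X : Type*} [MetricSpace X] (T : X → X) (n : ℕ) (x y : X) :
    0 ≤ weakMeanN T n x y :=
  mul_nonneg (by positivity)
    (Real.iInf_nonneg fun _ => Finset.sum_nonneg fun _ _ => dist_nonneg)

/-- If `X` has diameter at most `D` and is labelled by finitely many labels, each of whose classes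
has diameter at most `r`, then `weakMeanN` is controlled by the visit frequencies. -/
theorem weakMeanN_le_add_sum {X : Type*} [MetricSpace X] (T : X → X) {c : X → ℕ}
    {s : Finset ℕ} (hs : ∀ x, c x ∈ s) {r D : ℝ} (hr : 0 ≤ r)
    (hc : ∀ x y, c x = c y → dist x y ≤ r) (hD : ∀ x y : X, dist x y ≤ D) {n : ℕ} (hn : 0 < n)
    (x y : X) :
    weakMeanN T n x y ≤ r + D * ∑ j ∈ s,
      |birkhoffAverage ℝ T ((c ⁻¹' {j}).indicator fun _ => (1 : ℝ)) n x -
        birkhoffAverage ℝ T ((c ⁻¹' {j}).indicator fun _ => (1 : ℝ)) n y| := by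
  have hD0 : 0 ≤ D := dist_nonneg.trans (hD x x)
  have hn' : (0 : ℝ) < n := by exact_mod_cast hn
  obtain ⟨σ, hσ⟩ := exists_perm_card_ne_le (fun k : Fin n => c (T^[k] x))
    (fun k : Fin n => c (T^[k] y)) s fun k => hs _
  have hσ' : ((Finset.univ.filter fun k : Fin n => c (T^[k] x) ≠ c (T^[σ k] y)).card : ℝ) ≤
      ∑ j ∈ s, |birkhoffSum T ((c ⁻¹' {j}).indicator fun _ => (1 : ℝ)) n x -
        birkhoffSum T ((c ⁻¹' {j}).indicator fun _ => (1 : ℝ)) n y| := by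
    simp only [birkhoffSum_indicator_preimage]
    exact_mod_cast hσ
  have hsum : ∑ k : Fin n, dist (T^[k] x) (T^[σ k] y) ≤
      n * r + D * (Finset.univ.filter fun k : Fin n => c (T^[k] x) ≠ c (T^[σ k] y)).card := by
    calc ∑ k : Fin n, dist (T^[k] x) (T^[σ k] y)
        ≤ ∑ k : Fin n, (r + D * if c (T^[k] x) ≠ c (T^[σ k] y) then 1 else 0) := by
          refine Finset.sum_le_sum fun k _ => ?_
          split_ifs with h
          · linarith [hD (T^[k] x) (T^[σ k] y)]
          · simpa using hc _ _ (not_not.1 h)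
      _ = _ := by
          rw [Finset.sum_add_distrib, ← Finset.mul_sum, Finset.sum_boole]
          simp
  have hinf : (⨅ σ : Equiv.Perm (Fin n), ∑ k : Fin n, dist (T^[k] x) (T^[σ k] y)) ≤
      n * r + D * ∑ j ∈ s, |birkhoffSum T ((c ⁻¹' {j}).indicator fun _ => (1 : ℝ)) n x -
        birkhoffSum T ((c ⁻¹' {j}).indicator fun _ => (1 : ℝ)) n y| :=
    (ciInf_le (Set.finite_range _).bddBelow σ).trans
      (hsum.trans (add_le_add le_rfl (mul_le_mul_of_nonneg_left hσ' hD0)))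
  simp only [birkhoffAverage, smul_eq_mul, ← mul_sub, abs_mul, abs_inv, abs_of_pos hn',
    ← Finset.mul_sum]
  rw [weakMeanN, one_div]
  refine (mul_le_mul_of_nonneg_left hinf (by positivity)).trans (le_of_eq ?_)
  field_simp

/-- A compact space has a measurable labelling by finitely many labels whose classes are small. -/
theorem exists_simpleFunc_dist_le {X : Type*} [MetricSpace X] [CompactSpace X]
    [MeasurableSpace X] [OpensMeasurableSpace X] [Nonempty X] {r : ℝ} (hr : 0 < r) :
    ∃ c : SimpleFunc X ℕ, ∀ x y, c x = c y → dist x y ≤ r := by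
  let e := TopologicalSpace.denseSeq X
  obtain ⟨t, ht⟩ := isCompact_univ.elim_finite_subcover (fun i => Metric.ball (e i) (r / 2))
    (fun i => Metric.isOpen_ball) (by
      intro x _
      obtain ⟨i, hi⟩ := (TopologicalSpace.denseRange_denseSeq X).exists_dist_lt x (half_pos hr)
      exact Set.mem_iUnion.2 ⟨i, hi⟩)
  have hnear : ∀ x, dist (SimpleFunc.nearestPt e (t.sup id) x) x ≤ r / 2 := by
    intro x
    obtain ⟨i, hi, hx⟩ := Set.mem_iUnion₂.1 (ht (Set.mem_univ x))
    have h := SimpleFunc.edist_nearestPt_le e x (Finset.le_sup (f := id) hi)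
    rw [edist_dist, edist_dist, ENNReal.ofReal_le_ofReal_iff dist_nonneg, dist_comm (e _)] at h
    exact h.trans (Metric.mem_ball.1 hx).le
  refine ⟨SimpleFunc.nearestPtInd e (t.sup id), fun x y hxy => ?_⟩
  have h : SimpleFunc.nearestPt e (t.sup id) x = SimpleFunc.nearestPt e (t.sup id) y := by
    simp only [SimpleFunc.nearestPt, SimpleFunc.map_apply, hxy]
  have hx := hnear x
  rw [h] at hx
  linarith [dist_triangle_left x y (SimpleFunc.nearestPt e (t.sup id) y), hnear y]

end WeakMean

theorem theorem3p3 {X : Type*} [MetricSpace X] [CompactSpace X] [MeasurableSpace X] [BorelSpace X]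
    (T : X → X) (hT : Continuous T)
    (μ : Measure X) [IsProbabilityMeasure μ] (hμ : MeasurePreserving T μ μ) :
    WeakMean.IsMuFEquicontinuous T μ := by
  have : Nonempty X := μ.nonempty_of_neZero
  choose c hc using fun m : ℕ => WeakMean.exists_simpleFunc_dist_le (X := X)
    (r := 1 / ((m : ℝ) + 1)) (by positivity)
  let φ : ℕ × ℕ → X → ℝ := fun p => (c p.1 ⁻¹' {p.2}).indicator fun _ => 1
  have hφm : ∀ p, Measurable (φ p) := fun p =>
    measurable_const.indicator ((c p.1).measurableSet_preimage _)
  have hφ1 : ∀ p x, |φ p x| ≤ 1 := fun p x => by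
    refine (norm_indicator_le_norm_self (fun _ => (1 : ℝ)) x).trans ?_
    simp
  choose g hgm hg using fun p => measurable_limit_of_tendsto_metrizable_ae
    (fun n => (WeakMean.measurable_birkhoffAverage hμ.measurable (hφm p) n).aemeasurable)
    (WeakMean.ae_exists_tendsto_birkhoffAverage hμ (hφm p) (hφ1 p))
  intro τ hτ
  -- All limit frequencies are taken together as one map into a countable product, so that `M` is
  -- chosen before `ε`.
  obtain ⟨M, hMc, hMμ, hMg, hMcont⟩ := WeakMean.exists_isCompact_continuousOn μ
    (f := fun x p => g p x) (measurable_pi_lambda _ hgm) (ae_all_iff.2 hg)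
    (ε := ENNReal.ofReal τ) (by simpa using hτ)
  refine ⟨M, hMc, ?_, fun ε hε => ?_⟩
  · have h1 : μ.real Mᶜ < τ := by
      rw [measureReal_def]
      exact (ENNReal.lt_ofReal_iff_toReal_lt (measure_ne_top _ _)).1 hMμ
    rw [probReal_compl_eq_one_sub hMc.measurableSet] at h1
    linarith
  obtain ⟨m, hm⟩ := exists_nat_one_div_lt (half_pos hε)
  let s := (c m).range
  have hcont : ContinuousOn (fun z : X × X => Metric.diam (Set.univ : Set X) *
      ∑ j ∈ s, |g (m, j) z.1 - g (m, j) z.2|) (M ×ˢ M) := by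
    have hgc : ∀ p, ContinuousOn (g p) M := fun p =>
      (continuous_apply p).comp_continuousOn hMcont
    refine continuousOn_const.mul (continuousOn_finsetSum _ fun j _ => ?_)
    exact (((hgc _).comp continuousOn_fst fun z hz => hz.1).sub
      ((hgc _).comp continuousOn_snd fun z hz => hz.2)).abs
  obtain ⟨δ, hδ, hδε⟩ := Metric.uniformContinuousOn_iff.1
    ((hMc.prod hMc).uniformContinuousOn_of_continuous hcont) (ε / 2 / 2) (by positivity)
  refine ⟨δ, hδ, fun x hx y hy hxy => ?_⟩
  -- The function vanishes on the diagonal, so uniform continuity bounds its value at `(x, y)`.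
  have h1 := hδε (x, y) ⟨hx, hy⟩ (x, x) ⟨hx, hx⟩
    (by simpa [Prod.dist_eq, dist_comm y x] using hxy)
  simp only [sub_self, abs_zero, Finset.sum_const_zero, mul_zero, dist_zero_right,
    Real.norm_eq_abs] at h1
  replace h1 := (le_abs_self _).trans_lt h1
  have hlim : Tendsto (fun n => Metric.diam (Set.univ : Set X) *
      ∑ j ∈ s, |birkhoffAverage ℝ T (φ (m, j)) n x - birkhoffAverage ℝ T (φ (m, j)) n y|) atTop
      (nhds (Metric.diam (Set.univ : Set X) * ∑ j ∈ s, |g (m, j) x - g (m, j) y|)) :=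
    (tendsto_finsetSum _ fun j _ => ((hMg x hx (m, j)).sub (hMg y hy (m, j))).abs).const_mul _
  have hev : ∀ᶠ n in atTop, WeakMean.weakMeanN T n x y ≤ 1 / ((m : ℝ) + 1) + ε / 2 / 2 := by
    filter_upwards [hlim.eventually (gt_mem_nhds h1), eventually_gt_atTop 0] with n hn hn0
    refine (WeakMean.weakMeanN_le_add_sum T (s := s) (fun z => (c m).mem_range_self z)
      (by positivity) (hc m) (fun a b => Metric.dist_le_diam_of_mem
        isCompact_univ.isBounded (Set.mem_univ a) (Set.mem_univ b)) hn0 x y).trans ?_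
    exact add_le_add le_rfl hn.le
  have hle : WeakMean.weakMean T x y ≤ 1 / ((m : ℝ) + 1) + ε / 2 / 2 :=
    -- The lower bound `0` keeps the real `limsup` from being a default value.
    limsup_le_of_le (isCoboundedUnder_le_of_le atTop (x := 0)
      fun n => WeakMean.weakMeanN_nonneg T n x y) hev
  linarith
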